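/- Let $m$ be Lebesgue measure on $(0,\infty)$. For a measurable, a.e. finite $x:(0,\infty)\to\mathbb R$ let $x^*(t)=\inf\{\tau\ge 0: m\{s>0:|x(s)|>\tau\}\le t\}$, $t>0$ (with $\inf\emptyset=\infty$). A rearrangement invariant (r.i.) space on $(0,\infty)$ is a real Banach space $X$ of (classes of) measurable a.e. finite functions on $(0,\infty)$ such that (1) if $y\in X$, $x$ is measurable and $|x|\le|y|$ a.e., then $x\in X$ and $\|x\|_X\le\|y\|_X$; and (2) if $y\in X$, $x$ is measurable and a.e. finite, and $x^*(t)\le y^*(t)$ for all $t>0$, then $x\in X$ and $\|x\|_X\le\|y\|_X$. Let $\sigma$ be the (bounded) doubling operator $\sigma x(t)=x(t/2)$ on $X$. A number $\lambda\in\mathbb R$ is an approximate eigenvalue of $\sigma$ if there are $u_n\in X$ with $\|u_n\|_X=1$ and $\|\sigma u_n-\lambda u_n\|_X\to0$. Let $\varphi_X(t)=\|\chi_A\|_X$, where $m(A)=t$, be the fundamental function of $X\neq\{0\}$. For a positive function $\psi$ on $(0,\infty)$ put $$M_\psi(t)=\sup_{s>0}\frac{\psi(ts)}{\psi(s)},\qquad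 M^0_\psi(t)=\sup_{0<s\le\min(1,1/t)}\frac{\psi(ts)}{\psi(s)},\qquad M^\infty_\psi(t)=\sup_{s\ge\max(1,1/t)}\frac{\psi(ts)}{\psi(s)},$$ and, for $\psi=\varphi_X$ (in which case these suprema are finite and the following limits exist), $$\mu_\psi=-\lim_{n\to\infty}\tfrac1n\log_2M_\psi(2^{-n}),\quad \nu_\psi=\lim_{n\to\infty}\tfrac1n\log_2M_\psi(2^n),\quad \nu^0_\psi=\lim_{n\to\infty}\tfrac1n\log_2M^0_\psi(2^n),\quad \mu^\infty_\psi=-\lim_{n\to\infty}\tfrac1n\log_2M^\infty_\psi(2^{-n}).$$ **Theorem.** Let $X\ne\{0\}$ be a separable r.i. space on $(0,\infty)$. (i) If $\mu^\infty_{\varphi_X}\le\nu^0_{\varphi_X}$, then every point of $[2^{\mu_{\varphi_X}},2^{\nu_{\varphi_X}}]$ is an approximate eigenvalue of $\sigma$ in $X$. (ii) If $\mu^\infty_{\varphi_X}>\nu^0_{\varphi_X}$, then every point of $[2^{\mu_{\varphi_X}},2^{\nu^0_{\varphi_X}}]\cup[2^{\mu^\infty_{\varphi_X}},2^{\nu_{\varphi_X}}]$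 is an approximate eigenvalue of $\sigma$ in $X$. -/

import Mathlib

open MeasureTheory Set Filter Topology
open scoped ENNReal

noncomputable section

/-- Lebesgue measure on the half-line `(0, ∞)`. -/
abbrev halfLine : Measure ℝ := volume.restrict (Ioi 0)

/-- Classes modulo a.e. equality of measurable, a.e. finite real functions on `(0, ∞)`. -/
abbrev HalfLineFun : Type := ℝ →ₘ[halfLine] ℝ

/-- The distribution function `τ ↦ m {s > 0 : |x s| > τ}`. -/
def distribution (x : HalfLineFun) (τ : ℝ≥0∞) : ℝ≥0∞ :=
  halfLine {s | τ < ‖x s‖ₑ}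

/-- The decreasing rearrangement `x* t = inf {τ ≥ 0 : m {s > 0 : |x s| > τ} ≤ t}`.
It takes values in `[0, ∞]`; the value `∞` is taken when no finite `τ` qualifies. -/
def rearrangement (x : HalfLineFun) (t : ℝ) : ℝ≥0∞ :=
  sInf {τ : ℝ≥0∞ | distribution x τ ≤ ENNReal.ofReal t}

/-- A linear space of functions on `(0, ∞)` together with a norm on it. -/
structure FunctionSpace where
  /-- the functions that belong to the space -/
  carrier : Submodule ℝ HalfLineFun
  /-- the norm -/
  nrm : AddGroupNorm carrier
  nrm_smul : ∀ (c : ℝ) (x : carrier), nrm (c • x) = |c| * nrm x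

instance FunctionSpace.instNormedAddCommGroup (X : FunctionSpace) :
    NormedAddCommGroup X.carrier :=
  X.nrm.toNormedAddCommGroup

instance FunctionSpace.instNormedSpace (X : FunctionSpace) : NormedSpace ℝ X.carrier where
  norm_smul_le c x := (X.nrm_smul c x).le

/-- The normed function space `X` is a rearrangement invariant Banach function lattice. -/
structure FunctionSpace.IsRearrangementInvariant (X : FunctionSpace) : Prop where
  /-- the space is complete -/
  complete : CompleteSpace X.carrier
  /-- the space is a function lattice -/
  ideal : ∀ (x : HalfLineFun) (y : X.carrier), (∀ᵐ s ∂halfLine, |x s| ≤ |y.1 s|) →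
    ∃ h : x ∈ X.carrier, ‖(⟨x, h⟩ : X.carrier)‖ ≤ ‖y‖
  /-- the space is rearrangement invariant -/
  rearr : ∀ (x : HalfLineFun) (y : X.carrier),
    (∀ t : ℝ, 0 < t → rearrangement x t ≤ rearrangement y.1 t) →
      ∃ h : x ∈ X.carrier, ‖(⟨x, h⟩ : X.carrier)‖ ≤ ‖y‖

/-- A rearrangement invariant Banach function space on `(0, ∞)`. -/
structure RISpace extends FunctionSpace where
  isRearrangementInvariant : toFunctionSpace.IsRearrangementInvariant

lemma RISpace.of_distribution_le (X : RISpace) (x : HalfLineFun) (y : X.carrier)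
    (h : ∀ τ, distribution x τ ≤ distribution y.1 τ) :
    ∃ h : x ∈ X.carrier, ‖(⟨x, h⟩ : X.carrier)‖ ≤ ‖y‖ :=
  X.isRearrangementInvariant.rearr x y fun _ _ => sInf_le_sInf fun τ hτ => (h τ).trans hτ

lemma distribution_congr {x : HalfLineFun} {f : ℝ → ℝ} (h : x =ᵐ[halfLine] f) (τ : ℝ≥0∞) :
    distribution x τ = halfLine {s | τ < ‖f s‖ₑ} := by
  refine measure_congr ?_
  filter_upwards [h] with s hs
  change (τ < ‖x s‖ₑ) = (τ < ‖f s‖ₑ)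
  rw [hs]

/-! ### The doubling operator -/

lemma quasiMeasurePreserving_half :
    Measure.QuasiMeasurePreserving (fun t : ℝ => t / 2) halfLine halfLine := by
  refine ⟨by fun_prop, Measure.AbsolutelyContinuous.mk fun s hs h => ?_⟩
  rw [Measure.map_apply (by fun_prop) hs, Measure.restrict_apply (by measurability)]
  rw [Measure.restrict_apply hs] at h
  have : (fun t : ℝ => t / 2) ⁻¹' s ∩ Ioi 0 = (fun t : ℝ => t * (2⁻¹ : ℝ)) ⁻¹' (s ∩ Ioi 0) := by
    ext t; simp [div_eq_mul_inv]
  rw [this, Real.volume_preimage_mul_right (by norm_num), h, mul_zero]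

/-- The function `t ↦ x (t / 2)`. -/
def dilateTwo (x : HalfLineFun) : HalfLineFun :=
  x.compQuasiMeasurePreserving (fun t => t / 2) quasiMeasurePreserving_half

lemma coeFn_dilateTwo (x : HalfLineFun) :
    dilateTwo x =ᵐ[halfLine] fun t => x (t / 2) :=
  AEEqFun.coeFn_compQuasiMeasurePreserving x quasiMeasurePreserving_half

lemma dilateTwo_add (x y : HalfLineFun) :
    dilateTwo (x + y) = dilateTwo x + dilateTwo y := by
  ext
  filter_upwards [coeFn_dilateTwo (x + y), coeFn_dilateTwo x, coeFn_dilateTwo y,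
    AEEqFun.coeFn_add (dilateTwo x) (dilateTwo y),
    quasiMeasurePreserving_half.ae (AEEqFun.coeFn_add x y)] with t h1 h2 h3 h4 h5
  rw [h1, h4, Pi.add_apply, h2, h3, h5, Pi.add_apply]

lemma dilateTwo_smul (c : ℝ) (x : HalfLineFun) :
    dilateTwo (c • x) = c • dilateTwo x := by
  ext
  filter_upwards [coeFn_dilateTwo (c • x), coeFn_dilateTwo x,
    AEEqFun.coeFn_smul c (dilateTwo x),
    quasiMeasurePreserving_half.ae (AEEqFun.coeFn_smul c x)] with t h1 h2 h3 h4
  rw [h1, h3, Pi.smul_apply, h2, h4, Pi.smul_apply]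

/-- The half-open unit intervals whose left end point is congruent to `e` modulo `2`. -/
def stripes (e : ℤ) : Set ℝ := ⋃ k : ℤ, Ico (2 * k + e : ℝ) (2 * k + e + 1)

/-- On `stripes e`, this translates `[2k + e, 2k + e + 1)` to `[k, k + 1)`. -/
def unstripe (e : ℤ) (t : ℝ) : ℝ := t - ⌊(t - e) / 2⌋ - e

lemma measurable_unstripe (e : ℤ) : Measurable (unstripe e) := by
  unfold unstripe
  exact (measurable_id.sub ((measurable_from_top (f := fun z : ℤ => (z : ℝ))).comp
    (Int.measurable_floor.comp (by fun_prop)))).sub_const _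

lemma unstripe_eq {e k : ℤ} {t : ℝ} (h : t ∈ Ico (2 * k + e : ℝ) (2 * k + e + 1)) :
    unstripe e t = t - (k + e) := by
  have : ⌊(t - e) / 2⌋ = k := by
    rw [Int.floor_eq_iff]
    constructor <;> linarith [h.1, h.2]
  rw [unstripe, this]; ring

lemma measurableSet_stripes (e : ℤ) : MeasurableSet (stripes e) :=
  MeasurableSet.iUnion fun _ => measurableSet_Ico

lemma volume_stripes_inter (e : ℤ) {S : Set ℝ} (hS : MeasurableSet S) :
    volume (stripes e ∩ unstripe e ⁻¹' S) = volume S := by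
  have h1 : stripes e ∩ unstripe e ⁻¹' S =
      ⋃ k : ℤ, (fun t : ℝ => t - (k + e)) ⁻¹' (S ∩ Ico (k : ℝ) (k + 1)) := by
    ext t
    simp only [stripes, mem_inter_iff, mem_iUnion, mem_preimage]
    constructor
    · rintro ⟨⟨k, hk⟩, hS⟩
      rw [unstripe_eq hk] at hS
      exact ⟨k, hS, by linarith [hk.1], by linarith [hk.2]⟩
    · rintro ⟨k, hS, hk⟩
      have hk' : t ∈ Ico (2 * k + e : ℝ) (2 * k + e + 1) :=
        ⟨by linarith [hk.1], by linarith [hk.2]⟩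
      exact ⟨⟨k, hk'⟩, by rwa [unstripe_eq hk']⟩
  have h2 : S = ⋃ k : ℤ, (S ∩ Ico (k : ℝ) (k + 1)) := by
    rw [← inter_iUnion, iUnion_Ico_intCast, inter_univ]
  have hd : Pairwise (Function.onFun Disjoint fun k : ℤ => S ∩ Ico (k : ℝ) (k + 1)) :=
    fun i j hij => (pairwise_disjoint_Ico_intCast ℝ hij).mono inter_subset_right inter_subset_right
  have hm : ∀ k : ℤ, MeasurableSet (S ∩ Ico (k : ℝ) (k + 1)) := fun k => hS.inter measurableSet_Ico
  conv_rhs => rw [h2, measure_iUnion hd hm]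
  rw [h1, measure_iUnion]
  · exact tsum_congr fun k => by
      simpa only [sub_eq_add_neg] using measure_preimage_add_right volume (-(k + e : ℝ)) _
  · intro i j hij
    refine disjoint_left.2 ?_
    rintro t ⟨-, hi⟩ ⟨-, hj⟩
    apply hij
    have a1 := hi.1
    have a2 := hi.2
    have b1 := hj.1
    have b2 := hj.2
    simp only at a1 a2 b1 b2
    have c1 : (2 * i : ℝ) < 2 * j + 1 := by linarith
    have c2 : (2 * j : ℝ) < 2 * i + 1 := by linarith
    have d1 : 2 * i < 2 * j + 1 := by exact_mod_cast c1
    have d2 : 2 * j < 2 * i + 1 := by exact_mod_cast c2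
    omega
  · exact fun k => (measurable_id.sub_const _) (hm k)

lemma unstripe_nonneg_iff {e : ℤ} (he : e = 0 ∨ e = 1) {t : ℝ} (ht : t ∈ stripes e) :
    0 ≤ unstripe e t ↔ 0 ≤ t := by
  obtain ⟨k, hk⟩ := mem_iUnion.1 ht
  rw [unstripe_eq hk]
  obtain ⟨a, b⟩ := hk
  constructor
  · intro h
    have : (-1 : ℝ) < k := by linarith
    have h0 : (0 : ℤ) ≤ k := by
      have : (-1 : ℤ) < k := by exact_mod_cast this
      omega
    have h0' : (0 : ℝ) ≤ k := by exact_mod_cast h0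
    rcases he with rfl | rfl <;> push_cast at * <;> linarith
  · intro h
    have h1 : (0 : ℝ) < 2 * k + e + 1 := by linarith
    have h0 : (0 : ℤ) ≤ k := by
      have : (0 : ℤ) < 2 * k + e + 1 := by exact_mod_cast h1
      omega
    have h0' : (0 : ℝ) ≤ k := by exact_mod_cast h0
    linarith

lemma halfLine_apply {S : Set ℝ} (hS : MeasurableSet S) : halfLine S = volume (S ∩ Ici 0) := by
  rw [halfLine, Measure.restrict_congr_set Ioi_ae_eq_Ici, Measure.restrict_apply hS]

/-- A copy of `x`, equimeasurable with `x` and supported by `stripes e`. -/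
def stripeCopy (e : ℤ) (x : HalfLineFun) : HalfLineFun :=
  AEEqFun.mk ((stripes e).indicator fun t => x (unstripe e t))
    ((x.measurable.comp (measurable_unstripe e)).indicator
      (measurableSet_stripes e)).aestronglyMeasurable

lemma measurableSet_superlevel (x : HalfLineFun) (τ : ℝ≥0∞) :
    MeasurableSet {s | τ < ‖x s‖ₑ} :=
  measurableSet_lt measurable_const x.measurable.enorm

lemma halfLine_stripes {e : ℤ} (he : e = 0 ∨ e = 1) (x : HalfLineFun) (τ : ℝ≥0∞) :
    halfLine (stripes e ∩ {t | τ < ‖x (unstripe e t)‖ₑ}) = distribution x τ := by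
  have hS := measurableSet_superlevel x τ
  have hT : MeasurableSet (stripes e ∩ {t | τ < ‖x (unstripe e t)‖ₑ}) :=
    (measurableSet_stripes e).inter (measurable_unstripe e hS)
  rw [distribution, halfLine_apply hS, halfLine_apply hT,
    ← volume_stripes_inter e (hS.inter measurableSet_Ici)]
  congr 1
  ext t
  constructor
  · rintro ⟨⟨h1, h2⟩, h3⟩
    exact ⟨h1, h2, (unstripe_nonneg_iff he h1).2 h3⟩
  · rintro ⟨h1, h2, h3⟩
    exact ⟨⟨h1, h2⟩, (unstripe_nonneg_iff he h1).1 h3⟩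

lemma superlevel_indicator (B : Set ℝ) (f : ℝ → ℝ) (τ : ℝ≥0∞) :
    {s | τ < ‖B.indicator f s‖ₑ} = B ∩ {s | τ < ‖f s‖ₑ} := by
  ext t
  by_cases h : t ∈ B <;> simp [h]

lemma distribution_stripeCopy {e : ℤ} (he : e = 0 ∨ e = 1) (x : HalfLineFun) (τ : ℝ≥0∞) :
    distribution (stripeCopy e x) τ = distribution x τ := by
  rw [stripeCopy, distribution_congr (AEEqFun.coeFn_mk _ _), superlevel_indicator,
    halfLine_stripes he]

lemma disjoint_stripes : Disjoint (stripes 0) (stripes 1) := by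
  refine disjoint_left.2 fun t h0 h1 => ?_
  obtain ⟨k, a, b⟩ := mem_iUnion.1 h0
  obtain ⟨j, c, d⟩ := mem_iUnion.1 h1
  push_cast at *
  have h1 : (2 * k : ℝ) < 2 * j + 1 + 1 := by linarith
  have h2 : (2 * j + 1 : ℝ) < 2 * k + 1 := by linarith
  have h1' : 2 * k < 2 * j + 1 + 1 := by exact_mod_cast h1
  have h2' : 2 * j + 1 < 2 * k + 1 := by exact_mod_cast h2
  omega

lemma distribution_dilateTwo (x : HalfLineFun) (τ : ℝ≥0∞) :
    distribution (dilateTwo x) τ = distribution (stripeCopy 0 x + stripeCopy 1 x) τ := by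
  have hS := measurableSet_superlevel x τ
  have hL : distribution (dilateTwo x) τ = 2 * distribution x τ := by
    have hT : MeasurableSet {s : ℝ | τ < ‖x (s / 2)‖ₑ} :=
      (by fun_prop : Measurable fun t : ℝ => t / 2) hS
    rw [distribution_congr (coeFn_dilateTwo x), distribution, Measure.restrict_apply hS,
      Measure.restrict_apply hT]
    have : {s : ℝ | τ < ‖x (s / 2)‖ₑ} ∩ Ioi 0 =
        (fun t : ℝ => t * (2⁻¹ : ℝ)) ⁻¹' ({s | τ < ‖x s‖ₑ} ∩ Ioi 0) := by
      ext t; simp [div_eq_mul_inv]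
    rw [this, Real.volume_preimage_mul_right (by norm_num)]
    simp
  have hR : (stripeCopy 0 x + stripeCopy 1 x : HalfLineFun) =ᵐ[halfLine] fun t =>
      (stripes 0).indicator (fun t => x (unstripe 0 t)) t +
        (stripes 1).indicator (fun t => x (unstripe 1 t)) t := by
    have h0 : stripeCopy 0 x =ᵐ[halfLine] _ := AEEqFun.coeFn_mk _ _
    have h1 : stripeCopy 1 x =ᵐ[halfLine] _ := AEEqFun.coeFn_mk _ _
    filter_upwards [AEEqFun.coeFn_add (stripeCopy 0 x) (stripeCopy 1 x), h0, h1] with t h h0 h1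
    rw [h, Pi.add_apply, h0, h1]
  rw [hL, distribution_congr hR]
  have hU : {s : ℝ | τ < ‖(stripes 0).indicator (fun t => x (unstripe 0 t)) s +
        (stripes 1).indicator (fun t => x (unstripe 1 t)) s‖ₑ} =
      (stripes 0 ∩ {t | τ < ‖x (unstripe 0 t)‖ₑ}) ∪
        (stripes 1 ∩ {t | τ < ‖x (unstripe 1 t)‖ₑ}) := by
    ext t
    by_cases h0 : t ∈ stripes 0
    · have h1 : t ∉ stripes 1 := disjoint_left.1 disjoint_stripes h0
      simp [h0, h1]
    · by_cases h1 : t ∈ stripes 1 <;> simp [h0, h1]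
  have hT : MeasurableSet (stripes 1 ∩ {t | τ < ‖x (unstripe 1 t)‖ₑ}) :=
    (measurableSet_stripes 1).inter (measurable_unstripe 1 hS)
  rw [hU, measure_union (disjoint_stripes.mono inter_subset_left inter_subset_left) hT,
    halfLine_stripes (Or.inl rfl), halfLine_stripes (Or.inr rfl), two_mul]

lemma RISpace.dilateTwo_mem (X : RISpace) (x : X.carrier) :
    ∃ h : dilateTwo x.1 ∈ X.carrier, ‖(⟨dilateTwo x.1, h⟩ : X.carrier)‖ ≤ 2 * ‖x‖ := by
  obtain ⟨h0, n0⟩ := X.of_distribution_le (stripeCopy 0 x.1) x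
    fun τ => (distribution_stripeCopy (Or.inl rfl) x.1 τ).le
  obtain ⟨h1, n1⟩ := X.of_distribution_le (stripeCopy 1 x.1) x
    fun τ => (distribution_stripeCopy (Or.inr rfl) x.1 τ).le
  obtain ⟨h, n⟩ := X.of_distribution_le (dilateTwo x.1)
    ((⟨stripeCopy 0 x.1, h0⟩ : X.carrier) + ⟨stripeCopy 1 x.1, h1⟩) fun τ => by
      rw [Submodule.coe_add]
      exact (distribution_dilateTwo x.1 τ).le
  refine ⟨h, n.trans ((norm_add_le _ _).trans ?_)⟩
  linarith

/-- The doubling operator `σ x (t) = x (t / 2)` as a bounded linear operator on `X`. -/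
def RISpace.doubling (X : RISpace) : X.carrier →L[ℝ] X.carrier :=
  LinearMap.mkContinuous
    { toFun := fun x => ⟨dilateTwo x.1, (X.dilateTwo_mem x).1⟩
      map_add' := fun x y => Subtype.ext (dilateTwo_add x.1 y.1)
      map_smul' := fun c x => Subtype.ext (dilateTwo_smul c x.1) }
    2 fun x => (X.dilateTwo_mem x).2

/-- `ev` is an approximate eigenvalue of `T`. -/
def IsApproximateEigenvalue {E : Type*} [NormedAddCommGroup E] [NormedSpace ℝ E]
    (T : E →L[ℝ] E) (ev : ℝ) : Prop :=
  ∃ u : ℕ → E, (∀ n, ‖u n‖ = 1) ∧ Tendsto (fun n => ‖T (u n) - ev • u n‖) atTop (𝓝 0)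

/-! ### The fundamental function -/

/-- The class of the characteristic function of `(a, b)`, where `0 ≤ a`. -/
def charInterval (a b : ℝ) : HalfLineFun :=
  AEEqFun.mk ((Ioo a b).indicator fun _ => (1 : ℝ))
    (measurable_const.indicator measurableSet_Ioo).aestronglyMeasurable

lemma coeFn_charInterval (a b : ℝ) :
    charInterval a b =ᵐ[halfLine] (Ioo a b).indicator fun _ => (1 : ℝ) :=
  AEEqFun.coeFn_mk _ _

lemma distribution_charInterval {a : ℝ} (ha : 0 ≤ a) (b : ℝ) (τ : ℝ≥0∞) :
    distribution (charInterval a b) τ = if τ < 1 then ENNReal.ofReal (b - a) else 0 := by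
  rw [distribution_congr (coeFn_charInterval a b), superlevel_indicator]
  split_ifs with h
  · have : {s : ℝ | τ < ‖(1 : ℝ)‖ₑ} = univ := by simp [h]
    have hsub : Ioo a b ⊆ Ioi 0 := fun t ht => lt_of_le_of_lt ha ht.1
    rw [this, inter_univ, Measure.restrict_apply measurableSet_Ioo, inter_eq_left.2 hsub,
      Real.volume_Ioo]
  · have : {s : ℝ | τ < ‖(1 : ℝ)‖ₑ} = ∅ := by simp [h]
    rw [this, inter_empty, measure_empty]

lemma exists_distribution_pos {y : HalfLineFun} (hy : y ≠ 0) :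
    ∃ c : ℝ, 0 < c ∧ 0 < distribution y (ENNReal.ofReal c) := by
  by_contra! hc
  apply hy
  have h : ∀ n : ℕ, ∀ᵐ s ∂halfLine, ‖y s‖ₑ ≤ ENNReal.ofReal (1 / (n + 1 : ℝ)) := by
    intro n
    have := nonpos_iff_eq_zero.1 (hc (1 / (n + 1 : ℝ)) (by positivity))
    rw [ae_iff]
    simpa [distribution] using this
  ext
  filter_upwards [ae_all_iff.2 h, AEEqFun.coeFn_zero (α := ℝ) (β := ℝ) (μ := halfLine)]
    with s hs h0
  rw [h0, Pi.zero_apply]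
  have hs' : ∀ n : ℕ, ‖y s‖ ≤ 1 / (n + 1 : ℝ) := fun n => by
    have := hs n
    rwa [← ofReal_norm, ENNReal.ofReal_le_ofReal_iff (by positivity)] at this
  exact norm_le_zero_iff.1 (ge_of_tendsto' tendsto_one_div_add_atTop_nhds_zero_nat hs')

lemma RISpace.charInterval_mem_aux (X : RISpace) [Nontrivial X.carrier] :
    ∃ d : ℝ, 0 < d ∧ ∀ a b : ℝ, 0 ≤ a → b - a ≤ d → charInterval a b ∈ X.carrier := by
  obtain ⟨y, hy⟩ := exists_ne (0 : X.carrier)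
  obtain ⟨c, hc, hd⟩ := exists_distribution_pos (y := y.1) (fun h => hy (Subtype.ext h))
  obtain ⟨d, hd0, hd1⟩ : ∃ d : ℝ, 0 < d ∧
      ENNReal.ofReal d ≤ distribution y.1 (ENNReal.ofReal c) := by
    obtain ⟨q, h0, h1⟩ := ENNReal.lt_iff_exists_nnreal_btwn.1 hd
    exact ⟨q, by exact_mod_cast h0, by simpa using h1.le⟩
  refine ⟨d, hd0, fun a b ha hab => ?_⟩
  refine (X.of_distribution_le (charInterval a b) (c⁻¹ • y) fun τ => ?_).1
  rw [distribution_charInterval ha]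
  split_ifs with hτ
  · refine (ENNReal.ofReal_le_ofReal hab).trans (hd1.trans ?_)
    have h : (c⁻¹ • y).1 =ᵐ[halfLine] fun s => c⁻¹ * y.1 s := AEEqFun.coeFn_smul c⁻¹ y.1
    rw [distribution_congr h, distribution]
    refine measure_mono fun s hs => ?_
    have hs' : c < ‖y.1 s‖ := by
      have : ENNReal.ofReal c < ‖y.1 s‖ₑ := hs
      rwa [← ofReal_norm, ENNReal.ofReal_lt_ofReal_iff_of_nonneg hc.le] at this
    refine hτ.trans ?_
    rw [← ofReal_norm, ← ENNReal.ofReal_one, ENNReal.ofReal_lt_ofReal_iff_of_nonneg zero_le_one,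
      norm_mul, Real.norm_of_nonneg (inv_nonneg.2 hc.le), inv_mul_eq_div, one_lt_div hc]
    exact hs'
  · exact zero_le

lemma RISpace.charInterval_mem (X : RISpace) [Nontrivial X.carrier] (t : ℝ) :
    charInterval 0 t ∈ X.carrier := by
  obtain ⟨d, hd, h⟩ := X.charInterval_mem_aux
  suffices H : ∀ n : ℕ, ∀ t : ℝ, t ≤ n * d → charInterval 0 t ∈ X.carrier by
    obtain ⟨n, hn⟩ := exists_nat_ge (t / d)
    exact H n t ((div_le_iff₀ hd).1 hn)
  intro n
  induction n with
  | zero =>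
    intro t ht
    refine h 0 t le_rfl ?_
    simp only [Nat.cast_zero, zero_mul] at ht
    linarith
  | succ n ih =>
    intro t ht
    push_cast at ht
    rcases le_total t (n * d) with h' | h'
    · exact ih t h'
    · have hnd : (0 : ℝ) ≤ n * d := by positivity
      have : charInterval 0 t = charInterval 0 (n * d) + charInterval (n * d) t := by
        ext
        have hne : ∀ᵐ s ∂halfLine, s ≠ n * d :=
          ae_restrict_of_ae (Measure.ae_ne volume _)
        filter_upwards [coeFn_charInterval 0 t, coeFn_charInterval 0 (n * d),
          coeFn_charInterval (n * d) t, AEEqFun.coeFn_add (charInterval 0 (n * d))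
          (charInterval (n * d) t), hne] with s h1 h2 h3 h4 h5
        rw [h4, Pi.add_apply, h1, h2, h3]
        rcases lt_or_gt_of_ne h5 with h6 | h6
        · have e1 : s ∉ Ioo (n * d) t := fun h => absurd h.1 (not_lt.2 h6.le)
          by_cases e0 : 0 < s
          · simp [indicator, e0, h6, h6.trans_le h', not_lt.2 h6.le]
          · simp [indicator, e0, not_lt.2 h6.le]
        · have e0 : 0 < s := lt_of_le_of_lt hnd h6
          simp [indicator, e0, h6, not_lt.2 h6.le]
      rw [this]
      exact X.carrier.add_mem (ih _ le_rfl) (h _ _ hnd (by linarith))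

/-- The fundamental function `φ_X t = ‖χ_A‖_X`, `m A = t`, evaluated at `A = (0, t)`
(the norm does not depend on the choice of `A`). -/
def RISpace.fundamental (X : RISpace) [Nontrivial X.carrier] (t : ℝ) : ℝ :=
  ‖(⟨charInterval 0 t, X.charInterval_mem t⟩ : X.carrier)‖

/-- The class of the characteristic function of a measurable subset of `(0, ∞)`. -/
def charSet (A : Set ℝ) (hA : MeasurableSet A) : HalfLineFun :=
  AEEqFun.mk (A.indicator fun _ => (1 : ℝ))
    (measurable_const.indicator hA).aestronglyMeasurable

/-- The value of the fundamental function can be computed from every set of the given measure. -/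
lemma RISpace.norm_charSet (X : RISpace) [Nontrivial X.carrier] {A : Set ℝ}
    (hA : MeasurableSet A) (h0 : A ⊆ Ioi 0) {t : ℝ} (ht : volume A = ENNReal.ofReal t) :
    ∃ h : charSet A hA ∈ X.carrier,
      ‖(⟨charSet A hA, h⟩ : X.carrier)‖ = X.fundamental t := by
  have hd : ∀ τ, distribution (charSet A hA) τ = distribution (charInterval 0 t) τ := by
    intro τ
    rw [distribution_charInterval le_rfl, charSet, distribution_congr (AEEqFun.coeFn_mk _ _),
      superlevel_indicator]
    split_ifs with h
    · have : {s : ℝ | τ < ‖(1 : ℝ)‖ₑ} = univ := by simp [h]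
      rw [this, inter_univ, Measure.restrict_apply hA, inter_eq_left.2 h0, ht, sub_zero]
    · have : {s : ℝ | τ < ‖(1 : ℝ)‖ₑ} = ∅ := by simp [h]
      rw [this, inter_empty, measure_empty]
  obtain ⟨h, n⟩ := X.of_distribution_le (charSet A hA)
    ⟨charInterval 0 t, X.charInterval_mem t⟩ fun τ => (hd τ).le
  obtain ⟨h', n'⟩ := X.of_distribution_le (charInterval 0 t)
    ⟨charSet A hA, h⟩ fun τ => (hd τ).ge
  exact ⟨h, le_antisymm n n'⟩

/-! ### Dilation functions and dilation indices -/

/-- `M_ψ t = sup_{s > 0} ψ (t s) / ψ s`. -/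
def dilationFn (ψ : ℝ → ℝ) (t : ℝ) : ℝ :=
  sSup ((fun s => ψ (t * s) / ψ s) '' Ioi 0)

/-- `M⁰_ψ t = sup_{0 < s ≤ min (1, 1 / t)} ψ (t s) / ψ s`. -/
def dilationFnZero (ψ : ℝ → ℝ) (t : ℝ) : ℝ :=
  sSup ((fun s => ψ (t * s) / ψ s) '' Ioc 0 (min 1 (1 / t)))

/-- `M^∞_ψ t = sup_{s ≥ max (1, 1 / t)} ψ (t s) / ψ s`. -/
def dilationFnInfty (ψ : ℝ → ℝ) (t : ℝ) : ℝ :=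
  sSup ((fun s => ψ (t * s) / ψ s) '' Ici (max 1 (1 / t)))

/-- `- lim_n (1 / n) log₂ M (2 ^ (-n))`. -/
def lowerIndex (M : ℝ → ℝ) : ℝ :=
  - limUnder atTop fun n : ℕ => 1 / (n : ℝ) * Real.logb 2 (M (2 ^ (-(n : ℤ))))

/-- `lim_n (1 / n) log₂ M (2 ^ n)`. -/
def upperIndex (M : ℝ → ℝ) : ℝ :=
  limUnder atTop fun n : ℕ => 1 / (n : ℝ) * Real.logb 2 (M (2 ^ n))

/-! ### The suprema and the limits in these definitions are finite and exist -/

lemma RISpace.fundamental_mono (X : RISpace) [Nontrivial X.carrier] : Monotone X.fundamental := by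
  intro s t hst
  refine (X.of_distribution_le (charInterval 0 s)
    ⟨charInterval 0 t, X.charInterval_mem t⟩ fun τ => ?_).2
  rw [distribution_charInterval le_rfl, distribution_charInterval le_rfl]
  split_ifs
  · exact ENNReal.ofReal_le_ofReal (by linarith)
  · exact le_rfl

lemma RISpace.fundamental_pos (X : RISpace) [Nontrivial X.carrier] {t : ℝ} (ht : 0 < t) :
    0 < X.fundamental t := by
  refine norm_pos_iff.2 fun h => ?_
  have h0 : charInterval 0 t = 0 := congrArg Subtype.val h
  have h1 := distribution_charInterval le_rfl t 0
  rw [h0, distribution_congr AEEqFun.coeFn_zero] at h1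
  simp only [Pi.zero_apply, enorm_zero, lt_self_iff_false, Set.ofPred_false, measure_empty,
    zero_lt_one, if_true, sub_zero] at h1
  exact absurd (ENNReal.ofReal_pos.2 ht) (by rw [← h1]; exact lt_irrefl _)

lemma RISpace.fundamental_two_mul_le (X : RISpace) [Nontrivial X.carrier] (t : ℝ) :
    X.fundamental (2 * t) ≤ 2 * X.fundamental t := by
  obtain ⟨h, n⟩ := X.dilateTwo_mem ⟨charInterval 0 t, X.charInterval_mem t⟩
  refine le_trans (X.of_distribution_le (charInterval 0 (2 * t)) ⟨_, h⟩ fun τ => ?_).2 n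
  have : charInterval 0 (2 * t) = dilateTwo (charInterval 0 t) := by
    ext
    filter_upwards [coeFn_charInterval 0 (2 * t), coeFn_dilateTwo (charInterval 0 t),
      quasiMeasurePreserving_half.ae (coeFn_charInterval 0 t)] with s h1 h2 h3
    rw [h1, h2, h3]
    have : s ∈ Ioo 0 (2 * t) ↔ s / 2 ∈ Ioo 0 t := by
      constructor <;> rintro ⟨a, b⟩ <;> constructor <;> linarith
    simp only [indicator, this]
  rw [this]

lemma RISpace.fundamental_pow_mul_le (X : RISpace) [Nontrivial X.carrier] (n : ℕ) (t : ℝ) :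
    X.fundamental (2 ^ n * t) ≤ 2 ^ n * X.fundamental t := by
  induction n with
  | zero => simp
  | succ n ih =>
    rw [pow_succ', mul_assoc, mul_assoc]
    exact (X.fundamental_two_mul_le _).trans (by linarith)

lemma RISpace.bddAbove_dilation (X : RISpace) [Nontrivial X.carrier] {D : Set ℝ}
    (hD : D ⊆ Ioi 0) (t : ℝ) :
    BddAbove ((fun s => X.fundamental (t * s) / X.fundamental s) '' D) := by
  obtain ⟨n, hn⟩ := pow_unbounded_of_one_lt t (one_lt_two : (1 : ℝ) < 2)
  refine ⟨2 ^ n, ?_⟩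
  rintro _ ⟨s, hs, rfl⟩
  have hs0 : 0 < s := hD hs
  refine (div_le_iff₀ (X.fundamental_pos hs0)).2 (le_trans (X.fundamental_mono ?_)
    (X.fundamental_pow_mul_le n s))
  exact mul_le_mul_of_nonneg_right hn.le hs0.le

lemma RISpace.exists_tendsto_dilation (X : RISpace) [Nontrivial X.carrier] {b : ℝ}
    (hb : b = 2 ∨ b = 2⁻¹) (D : ℕ → Set ℝ) (hD : ∀ n, D n ⊆ Ioi 0) (hne : ∀ n, (D n).Nonempty)
    (hmul : ∀ m n, ∀ s ∈ D (m + n), s ∈ D m ∧ b ^ m * s ∈ D n) :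
    ∃ l : ℝ, Tendsto (fun n : ℕ => 1 / (n : ℝ) * Real.logb 2
      (sSup ((fun s => X.fundamental (b ^ n * s) / X.fundamental s) '' D n))) atTop (𝓝 l) := by
  have hb0 : 0 < b := by rcases hb with rfl | rfl <;> norm_num
  set M : ℕ → ℝ := fun n =>
    sSup ((fun s => X.fundamental (b ^ n * s) / X.fundamental s) '' D n) with hM
  have hbd : ∀ n, BddAbove ((fun s => X.fundamental (b ^ n * s) / X.fundamental s) '' D n) :=
    fun n => X.bddAbove_dilation (hD n) _
  have hle : ∀ n, ∀ s ∈ D n, X.fundamental (b ^ n * s) / X.fundamental s ≤ M n :=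
    fun n s hs => le_csSup (hbd n) ⟨s, hs, rfl⟩
  have hlow : ∀ n, (2⁻¹ : ℝ) ^ n ≤ M n := by
    intro n
    obtain ⟨s, hs⟩ := hne n
    have hs0 : 0 < s := hD n hs
    refine le_trans ?_ (hle n s hs)
    rw [le_div_iff₀ (X.fundamental_pos hs0), inv_pow, inv_mul_le_iff₀ (by positivity)]
    refine le_trans (X.fundamental_mono ?_) (X.fundamental_pow_mul_le n (b ^ n * s))
    rcases hb with rfl | rfl
    · have : (1 : ℝ) ≤ 2 ^ n := one_le_pow₀ one_le_two
      have h2 : s ≤ 2 ^ n * s := le_mul_of_one_le_left hs0.le this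
      exact h2.trans (le_mul_of_one_le_left (by positivity) this)
    · rw [← mul_assoc, ← mul_pow, mul_inv_cancel₀ two_ne_zero, one_pow, one_mul]
  have hpos : ∀ n, 0 < M n := fun n => lt_of_lt_of_le (by positivity) (hlow n)
  have hsub : Subadditive fun n => Real.logb 2 (M n) := by
    intro m n
    simp only
    rw [← Real.logb_mul (hpos m).ne' (hpos n).ne']
    refine Real.logb_le_logb_of_le one_lt_two (hpos _) (csSup_le ((hne _).image _) ?_)
    rintro _ ⟨s, hs, rfl⟩
    obtain ⟨h1, h2⟩ := hmul m n s hs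
    have p1 := X.fundamental_pos (hD m h1)
    have p2 := X.fundamental_pos (hD n h2)
    have e : X.fundamental (b ^ (m + n) * s) / X.fundamental s =
        X.fundamental (b ^ m * s) / X.fundamental s *
          (X.fundamental (b ^ n * (b ^ m * s)) / X.fundamental (b ^ m * s)) := by
      rw [show b ^ (m + n) * s = b ^ n * (b ^ m * s) by ring]
      rw [div_mul_div_comm, mul_comm (X.fundamental s), mul_div_mul_left _ _ p2.ne']
    simp only [e]
    exact mul_le_mul (hle m s h1) (hle n _ h2)
      (div_nonneg (norm_nonneg _) p2.le) (hpos m).le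
  refine ⟨hsub.lim, ?_⟩
  have hbelow : BddBelow (range fun n : ℕ => Real.logb 2 (M n) / n) := by
    refine ⟨-1, ?_⟩
    rintro _ ⟨n, rfl⟩
    rcases Nat.eq_zero_or_pos n with rfl | hn
    · simp
    · have hn' : (0 : ℝ) < n := by exact_mod_cast hn
      simp only
      rw [le_div_iff₀ hn']
      have := Real.logb_le_logb_of_le one_lt_two (by positivity) (hlow n)
      rw [Real.logb_pow, Real.logb_inv, Real.logb_self_eq_one one_lt_two] at this
      linarith
  refine (hsub.tendsto_lim hbelow).congr fun n => ?_
  rw [div_eq_mul_inv, mul_comm, one_div]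

lemma RISpace.tendsto_lowerIndex (X : RISpace) [Nontrivial X.carrier] :
    Tendsto (fun n : ℕ => 1 / (n : ℝ) * Real.logb 2
      (dilationFn X.fundamental (2 ^ (-(n : ℤ))))) atTop
      (𝓝 (-lowerIndex (dilationFn X.fundamental))) := by
  rw [lowerIndex, neg_neg]
  refine tendsto_nhds_limUnder ?_
  simp only [dilationFn, zpow_neg, zpow_natCast, ← inv_pow]
  exact X.exists_tendsto_dilation (Or.inr rfl) (fun _ => Ioi 0) (fun _ => subset_rfl)
    (fun _ => nonempty_Ioi) fun m n s (hs : 0 < s) =>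
      ⟨hs, show 0 < (2⁻¹ : ℝ) ^ m * s by positivity⟩

lemma RISpace.tendsto_upperIndex (X : RISpace) [Nontrivial X.carrier] :
    Tendsto (fun n : ℕ => 1 / (n : ℝ) * Real.logb 2 (dilationFn X.fundamental (2 ^ n))) atTop
      (𝓝 (upperIndex (dilationFn X.fundamental))) := by
  refine tendsto_nhds_limUnder ?_
  simp only [dilationFn]
  exact X.exists_tendsto_dilation (Or.inl rfl) (fun _ => Ioi 0) (fun _ => subset_rfl)
    (fun _ => nonempty_Ioi) fun m n s (hs : 0 < s) =>
      ⟨hs, show 0 < (2 : ℝ) ^ m * s by positivity⟩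

lemma RISpace.tendsto_lowerIndex_infty (X : RISpace) [Nontrivial X.carrier] :
    Tendsto (fun n : ℕ => 1 / (n : ℝ) * Real.logb 2
      (dilationFnInfty X.fundamental (2 ^ (-(n : ℤ))))) atTop
      (𝓝 (-lowerIndex (dilationFnInfty X.fundamental))) := by
  rw [lowerIndex, neg_neg]
  refine tendsto_nhds_limUnder ?_
  have hD : ∀ n : ℕ, max 1 (1 / (2⁻¹ : ℝ) ^ n) = 2 ^ n := fun n => by
    rw [one_div, inv_pow, inv_inv]
    exact max_eq_right (one_le_pow₀ one_le_two)
  simp only [dilationFnInfty, zpow_neg, zpow_natCast, ← inv_pow, hD]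
  refine X.exists_tendsto_dilation (Or.inr rfl) (fun n => Ici (2 ^ n))
    (fun n s (hs : 2 ^ n ≤ s) => lt_of_lt_of_le (by positivity) hs)
    (fun _ => nonempty_Ici) fun m n s (hs : 2 ^ (m + n) ≤ s) => ⟨?_, ?_⟩
  · refine le_trans ?_ hs
    exact pow_le_pow_right₀ one_le_two (by omega)
  · change (2 : ℝ) ^ n ≤ (2⁻¹ : ℝ) ^ m * s
    rw [inv_pow, le_inv_mul_iff₀ (by positivity), ← pow_add]
    exact hs

lemma RISpace.tendsto_upperIndex_zero (X : RISpace) [Nontrivial X.carrier] :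
    Tendsto (fun n : ℕ => 1 / (n : ℝ) * Real.logb 2 (dilationFnZero X.fundamental (2 ^ n))) atTop
      (𝓝 (upperIndex (dilationFnZero X.fundamental))) := by
  refine tendsto_nhds_limUnder ?_
  have hD : ∀ n : ℕ, min 1 (1 / (2 : ℝ) ^ n) = (2 ^ n)⁻¹ := fun n => by
    rw [one_div]
    exact min_eq_right (inv_le_one_of_one_le₀ (one_le_pow₀ one_le_two))
  simp only [dilationFnZero, hD]
  refine X.exists_tendsto_dilation (Or.inl rfl) (fun n => Ioc 0 ((2 ^ n)⁻¹))
    (fun n s hs => hs.1) (fun n => nonempty_Ioc.2 (by positivity)) fun m n s hs => ⟨⟨hs.1, ?_⟩, ?_⟩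
  · refine hs.2.trans (inv_anti₀ (by positivity) ?_)
    exact pow_le_pow_right₀ one_le_two (by omega)
  · have h0 : 0 < s := hs.1
    refine ⟨by positivity, ?_⟩
    have := hs.2
    rw [pow_add, mul_inv] at this
    rwa [← le_inv_mul_iff₀ (by positivity)]

end

/-! ### Approximate eigenvalues of weighted shifts -/

/-! The doubling operator sends the indicator e_k of (2^k, 2^(k+1)) to e_(k+1), and by rearrangement
invariance ‖e_k‖ = φ(2^k). On the span of these blocks it is therefore a shift, and Σ ev^(-k) e_k is
a formal eigenvector for ev. Damping it by ρ^(-|k-c|), with ρ slightly above 1, costs a relative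
error of order ρ - 1, and cutting it to a finite window leaves two boundary terms.

The boundary terms are small if φ(2^k)/(ev/ρ)^k rises by a large factor K from the left end of the
window up to the centre c, and φ(2^k)/(ev·ρ)^k falls by a factor K from some later index down to the
right end (`exists_approximate_eigenvector_of_shift`). Nothing is required between the rise and the
fall, but the rise must precede the fall.

The indices supply both: ev ≤ 2^ν gives rises of every size, since ev/ρ < 2^ν, and ev ≥ 2^μ gives
falls of every size (`RISpace.exists_rise`, `RISpace.exists_fall`). Their order is the real issue.
If ev ≤ 2^(ν⁰), large rises occur at indices k ≤ 0, and since the sequence varies boundedly on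
finite windows, they can be pushed to the left of any given fall (`exists_rise_left`). If ev ≥
2^(μ^∞), falls can be pushed to the right of any given rise (`exists_fall_right`). This gives the
two intervals in (ii); when μ^∞ ≤ ν⁰ they cover [2^μ, 2^ν]. -/

lemma isApproximateEigenvalue_of_forall_pos {E : Type*} [NormedAddCommGroup E] [NormedSpace ℝ E]
    {T : E →L[ℝ] E} {ev : ℝ}
    (h : ∀ δ : ℝ, 0 < δ → ∃ u : E, u ≠ 0 ∧ ‖T u - ev • u‖ ≤ δ * ‖u‖) :
    IsApproximateEigenvalue T ev := by
  choose u hu0 hu using fun n : ℕ => h (1 / (n + 1 : ℝ)) (by positivity)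
  have hpos : ∀ n, 0 < ‖u n‖ := fun n => norm_pos_iff.2 (hu0 n)
  refine ⟨fun n => ‖u n‖⁻¹ • u n, fun n => ?_, ?_⟩
  · rw [norm_smul, norm_inv, norm_norm, inv_mul_cancel₀ (hpos n).ne']
  · refine squeeze_zero (fun _ => norm_nonneg _) (fun n => ?_)
      tendsto_one_div_add_atTop_nhds_zero_nat
    rw [map_smul, smul_comm ev, ← smul_sub, norm_smul, norm_inv, norm_norm,
      inv_mul_le_iff₀ (hpos n), mul_comm]
    exact hu n

/-- The exponent is always 1 or -1, and 1 - ρ⁻¹ ≤ ρ - 1. This bounds the relative error caused by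
the damping factor when the index moves by one. -/
lemma abs_zpow_abs_sub_sub_one_le {ρ : ℝ} (hρ : 1 < ρ) (k c : ℤ) :
    |ρ ^ (|k - c| - |k - 1 - c|) - 1| ≤ ρ - 1 := by
  have hρ0 : 0 < ρ := by linarith
  rcases le_or_gt k c with h | h
  · have : |k - c| - |k - 1 - c| = -1 := by
      rw [abs_of_nonpos (by omega), abs_of_nonpos (by omega)]; ring
    rw [this, zpow_neg_one, abs_sub_comm,
      abs_of_nonneg (sub_nonneg.2 (inv_le_one_of_one_le₀ hρ.le))]
    have : ρ * ρ⁻¹ = 1 := mul_inv_cancel₀ hρ0.ne'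
    nlinarith [inv_pos.2 hρ0, inv_le_one_of_one_le₀ hρ.le]
  · have : |k - c| - |k - 1 - c| = 1 := by
      rw [abs_of_nonneg (by omega), abs_of_nonneg (by omega)]; ring
    rw [this, zpow_one, abs_of_nonneg (by linarith)]

/-- If `T` shifts the vectors `e k`, then the sum of `ev ^ (-k) * ρ ^ (-|k - c|) • e k` over a
window is an approximate eigenvector as soon as its extreme terms are relatively small. -/
lemma exists_approximate_eigenvector_of_shift {E : Type*} [NormedAddCommGroup E]
    [NormedSpace ℝ E] {T : E →L[ℝ] E} {e : ℤ → E} (hT : ∀ k, T (e k) = e (k + 1))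
    (hpos : ∀ k, 0 < ‖e k‖) (hstep : ∀ k, ‖e (k + 1)‖ ≤ 2 * ‖e k‖)
    (hlat : ∀ (S : Finset ℤ) (c d : ℤ → ℝ), (∀ k ∈ S, |c k| ≤ d k) →
      ‖∑ k ∈ S, c k • e k‖ ≤ ‖∑ k ∈ S, d k • e k‖)
    {ev ρ K : ℝ} (hev : 0 < ev) (hρ : 1 < ρ) (hK : 0 < K) {i₁ j₁ i₂ j₂ : ℤ}
    (h₁ : i₁ ≤ j₁) (h : j₁ ≤ i₂) (h₂ : i₂ ≤ j₂)
    (hrise : K * (‖e i₁‖ / (ev / ρ) ^ i₁) ≤ ‖e j₁‖ / (ev / ρ) ^ j₁)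
    (hfall : K * (‖e j₂‖ / (ev * ρ) ^ j₂) ≤ ‖e i₂‖ / (ev * ρ) ^ i₂) :
    ∃ u : E, u ≠ 0 ∧ ‖T u - ev • u‖ ≤ ((ρ - 1) * ev + (2 + ev) / K) * ‖u‖ := by
  have hρ0 : 0 < ρ := by linarith
  -- The damping is centred at the top of the rise: up to a constant, the weight is (ev / ρ)^(-k) to
  -- the left of `j₁` and (ev * ρ)^(-k) to the right, which are the normalisations in `hrise` and
  -- `hfall`.
  set w : ℤ → ℝ := fun k => ev ^ (-k) * ρ ^ (-|k - j₁|) with hw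
  have hw0 : ∀ k, 0 < w k := fun k => mul_pos (zpow_pos hev _) (zpow_pos hρ0 _)
  set S := Finset.Icc i₁ j₂ with hS
  set u := ∑ k ∈ S, w k • e k with hu
  have hterm : ∀ k ∈ S, w k * ‖e k‖ ≤ ‖u‖ := by
    intro k hk
    have := hlat S (fun l => if l = k then w k else 0) w fun l _ => by
      split_ifs with hl
      · rw [hl, abs_of_pos (hw0 k)]
      · rw [abs_zero]; exact (hw0 l).le
    simpa [ite_smul, Finset.sum_ite_eq', hk, norm_smul, abs_of_pos (hw0 k)] using this
  have hleft : ∀ k ≤ j₁, w k * ‖e k‖ = ρ ^ (-j₁) * (‖e k‖ / (ev / ρ) ^ k) := by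
    intro k hk
    simp only [hw]
    rw [abs_of_nonpos (by omega), show -(-(k - j₁)) = k + -j₁ by ring, zpow_add₀ hρ0.ne', div_zpow,
      zpow_neg ev]
    field_simp
  have hright : ∀ k, j₁ ≤ k → w k * ‖e k‖ = ρ ^ j₁ * (‖e k‖ / (ev * ρ) ^ k) := by
    intro k hk
    simp only [hw]
    rw [abs_of_nonneg (by omega), show -(k - j₁) = j₁ + -k by ring, zpow_add₀ hρ0.ne', mul_zpow,
      zpow_neg ev, zpow_neg ρ k]
    field_simp
  -- Each end term is at most 1 / K times another term of the window, the one at `j₁` or `i₂`, and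
  -- no single term exceeds `‖u‖`.
  have hend₁ : w i₁ * ‖e i₁‖ ≤ ‖u‖ / K := by
    rw [le_div_iff₀ hK]
    refine le_trans ?_ (hterm j₁ (Finset.mem_Icc.2 ⟨h₁, h.trans h₂⟩))
    rw [hleft _ h₁, hleft _ le_rfl, mul_assoc, mul_comm _ K]
    exact mul_le_mul_of_nonneg_left hrise (zpow_pos hρ0 _).le
  have hend₂ : w j₂ * ‖e j₂‖ ≤ ‖u‖ / K := by
    rw [le_div_iff₀ hK]
    refine le_trans ?_ (hterm i₂ (Finset.mem_Icc.2 ⟨h₁.trans h, h₂⟩))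
    rw [hright _ (h.trans h₂), hright _ h, mul_assoc, mul_comm _ K]
    exact mul_le_mul_of_nonneg_left hfall (zpow_pos hρ0 _).le
  have hu0 : u ≠ 0 := by
    refine norm_pos_iff.1 (lt_of_lt_of_le (mul_pos (hw0 j₁) (hpos j₁))
      (hterm j₁ (Finset.mem_Icc.2 ⟨h₁, h.trans h₂⟩)))
  refine ⟨u, hu0, ?_⟩
  have hTu : T u = w j₂ • e (j₂ + 1) - w (i₁ - 1) • e i₁ + ∑ k ∈ S, w (k - 1) • e k := by
    have hsum : ∑ k ∈ S, w k • e (k + 1) =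
        ∑ k ∈ Finset.Icc (i₁ + 1) (j₂ + 1), w (k - 1) • e k := by
      rw [hS, ← Finset.map_add_right_Icc, Finset.sum_map]
      simp
    -- The shifted window and the original one each become [i₁, j₂ + 1] after adding one point; the
    -- two added points are the boundary terms.
    have hA : insert i₁ (Finset.Icc (i₁ + 1) (j₂ + 1)) = insert (j₂ + 1) S := by
      ext k; simp only [hS, Finset.mem_insert, Finset.mem_Icc]; omega
    have hB := congrArg (fun F => ∑ k ∈ F, w (k - 1) • e k) hA
    rw [Finset.sum_insert (by simp), Finset.sum_insert (by simp [hS])] at hB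
    rw [hu, map_sum]
    simp only [map_smul, hT]
    rw [hsum, eq_sub_of_add_eq' hB]
    simp only [add_sub_cancel_right]
    abel
  have hratio : ∀ k, w (k - 1) = ev * w k * ρ ^ (|k - j₁| - |k - 1 - j₁|) := by
    intro k
    simp only [hw]
    rw [show -(k - 1) = 1 + -k by ring, zpow_add₀ hev.ne', zpow_one,
      show -|k - 1 - j₁| = -|k - j₁| + (|k - j₁| - |k - 1 - j₁|) by ring, zpow_add₀ hρ0.ne']
    ring
  have hsplit : T u - ev • u = w j₂ • e (j₂ + 1) - w (i₁ - 1) • e i₁ +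
      ∑ k ∈ S, (w (k - 1) - ev * w k) • e k := by
    rw [hTu, hu, Finset.smul_sum, add_sub_assoc, ← Finset.sum_sub_distrib]
    simp only [sub_smul, mul_smul]
  -- Coefficientwise the error is at most (ρ - 1) * ev times the coefficient of `u`, so the lattice
  -- property bounds the whole sum at once, independently of the window length.
  have hmid : ‖∑ k ∈ S, (w (k - 1) - ev * w k) • e k‖ ≤ (ρ - 1) * ev * ‖u‖ := by
    refine (hlat S _ (fun k => ((ρ - 1) * ev) * w k) fun k _ => ?_).trans_eq ?_
    · rw [hratio, show ev * w k * ρ ^ (|k - j₁| - |k - 1 - j₁|) - ev * w k =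
        ev * w k * (ρ ^ (|k - j₁| - |k - 1 - j₁|) - 1) by ring, abs_mul,
        abs_of_pos (mul_pos hev (hw0 k))]
      nlinarith [abs_zpow_abs_sub_sub_one_le hρ k j₁, mul_pos hev (hw0 k)]
    · simp only [mul_smul _ (w _)]
      rw [← Finset.smul_sum, norm_smul, Real.norm_of_nonneg
        (mul_nonneg (by linarith) hev.le)]
  have hfirst : w (i₁ - 1) ≤ ev * w i₁ := by
    rw [hratio]
    refine mul_le_of_le_one_right (mul_pos hev (hw0 _)).le (zpow_le_one_of_nonpos₀ hρ.le ?_)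
    rw [abs_of_nonpos (by omega), abs_of_nonpos (by omega)]
    omega
  have h1 : ‖w j₂ • e (j₂ + 1)‖ ≤ 2 * (‖u‖ / K) := by
    rw [norm_smul, Real.norm_of_nonneg (hw0 _).le]
    nlinarith [hstep j₂, hw0 j₂]
  have h2 : ‖w (i₁ - 1) • e i₁‖ ≤ ev * (‖u‖ / K) := by
    rw [norm_smul, Real.norm_of_nonneg (hw0 _).le]
    calc w (i₁ - 1) * ‖e i₁‖ ≤ ev * w i₁ * ‖e i₁‖ :=
          mul_le_mul_of_nonneg_right hfirst (norm_nonneg _)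
      _ = ev * (w i₁ * ‖e i₁‖) := by ring
      _ ≤ _ := mul_le_mul_of_nonneg_left hend₁ hev.le
  rw [hsplit]
  calc _ ≤ 2 * (‖u‖ / K) + ev * (‖u‖ / K) + (ρ - 1) * ev * ‖u‖ :=
        (norm_add_le _ _).trans (add_le_add ((norm_sub_le _ _).trans (add_le_add h1 h2)) hmid)
    _ = _ := by ring

lemma isApproximateEigenvalue_of_shift {E : Type*} [NormedAddCommGroup E]
    [NormedSpace ℝ E] {T : E →L[ℝ] E} {e : ℤ → E} (hT : ∀ k, T (e k) = e (k + 1))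
    (hpos : ∀ k, 0 < ‖e k‖) (hstep : ∀ k, ‖e (k + 1)‖ ≤ 2 * ‖e k‖)
    (hlat : ∀ (S : Finset ℤ) (c d : ℤ → ℝ), (∀ k ∈ S, |c k| ≤ d k) →
      ‖∑ k ∈ S, c k • e k‖ ≤ ‖∑ k ∈ S, d k • e k‖)
    {ev : ℝ} (hev : 0 < ev)
    (hpeak : ∀ ρ : ℝ, 1 < ρ → ∀ K : ℝ, 0 < K → ∃ i₁ j₁ i₂ j₂ : ℤ, i₁ ≤ j₁ ∧ j₁ ≤ i₂ ∧ i₂ ≤ j₂ ∧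
      K * (‖e i₁‖ / (ev / ρ) ^ i₁) ≤ ‖e j₁‖ / (ev / ρ) ^ j₁ ∧
      K * (‖e j₂‖ / (ev * ρ) ^ j₂) ≤ ‖e i₂‖ / (ev * ρ) ^ i₂) :
    IsApproximateEigenvalue T ev := by
  refine isApproximateEigenvalue_of_forall_pos fun δ hδ => ?_
  -- With these choices of ρ and K, the damping error (ρ - 1) * ev and the boundary error (2 + ev) /
  -- K are δ / 2 each.
  have hρ : 1 < 1 + δ / (2 * ev) := by linarith [show 0 < δ / (2 * ev) by positivity]
  have hK : 0 < (2 + ev) / (δ / 2) := by positivity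
  obtain ⟨i₁, j₁, i₂, j₂, h₁, h, h₂, hr, hf⟩ := hpeak _ hρ _ hK
  obtain ⟨u, hu0, hu⟩ := exists_approximate_eigenvector_of_shift hT hpos hstep hlat hev hρ hK
    h₁ h h₂ hr hf
  refine ⟨u, hu0, hu.trans_eq ?_⟩
  congr 1
  field_simp
  ring

/-! ### Large rises and falls of a positive sequence -/

lemma exists_forall_le_mul_of_pos {b : ℤ → ℝ} (hb : ∀ k, 0 < b k) (m n : ℤ) :
    ∃ C : ℝ, 1 ≤ C ∧ ∀ i ∈ Icc m n, ∀ j ∈ Icc m n, b j ≤ C * b i := by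
  -- The sum of all ratios dominates each of them; the added 1 gives 1 ≤ C even for an empty window.
  refine ⟨1 + ∑ p ∈ Finset.Icc m n ×ˢ Finset.Icc m n, b p.2 / b p.1, ?_, fun i hi j hj => ?_⟩
  · exact le_add_of_nonneg_right (Finset.sum_nonneg fun p _ => (div_pos (hb _) (hb _)).le)
  · rw [← div_le_iff₀ (hb i)]
    refine le_add_of_nonneg_of_le zero_le_one ?_
    exact Finset.single_le_sum (f := fun p : ℤ × ℤ => b p.2 / b p.1)
      (fun p _ => (div_pos (hb _) (hb _)).le) (a := (i, j))
      (Finset.mem_product.2 ⟨Finset.mem_Icc.2 hi, Finset.mem_Icc.2 hj⟩)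

/-- Arbitrarily large rises on the negative half-axis occur to the left of every point. -/
lemma exists_rise_left {b : ℤ → ℝ} (hb : ∀ k, 0 < b k)
    (h : ∀ K : ℝ, 0 < K → ∃ i j : ℤ, i ≤ j ∧ j ≤ 0 ∧ K * b i ≤ b j) (N : ℤ) {K : ℝ}
    (hK : 0 < K) : ∃ i j : ℤ, i ≤ j ∧ j ≤ N ∧ K * b i ≤ b j := by
  obtain ⟨C, hC1, hC⟩ := exists_forall_le_mul_of_pos hb N 0
  -- A rise larger than C cannot lie inside [N, 0]. If it straddles N, stopping it at N loses at
  -- most the factor C. Using K + 1 makes the first claim strict even for small K.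
  obtain ⟨i, j, hij, hj, hr⟩ := h (C * (K + 1)) (by positivity)
  rcases le_or_gt j N with hjN | hjN
  · refine ⟨i, j, hij, hjN, le_trans ?_ hr⟩
    exact mul_le_mul_of_nonneg_right (by nlinarith) (hb i).le
  have hi : i ≤ N := by
    by_contra! hi
    have := hC i ⟨hi.le, hij.trans hj⟩ j ⟨hjN.le, hj⟩
    nlinarith [mul_pos (mul_pos (lt_of_lt_of_le one_pos hC1) hK) (hb i)]
  refine ⟨i, N, hi, le_rfl, ?_⟩
  have := hr.trans (hC N ⟨le_rfl, hjN.le.trans hj⟩ j ⟨hjN.le, hj⟩)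
  rw [mul_assoc] at this
  have := le_of_mul_le_mul_left this (lt_of_lt_of_le one_pos hC1)
  nlinarith [hb i]

/-- Arbitrarily large falls on the positive half-axis occur to the right of every point. -/
lemma exists_fall_right {b : ℤ → ℝ} (hb : ∀ k, 0 < b k)
    (h : ∀ K : ℝ, 0 < K → ∃ i j : ℤ, i ≤ j ∧ 0 ≤ i ∧ K * b j ≤ b i) (N : ℤ) {K : ℝ}
    (hK : 0 < K) : ∃ i j : ℤ, i ≤ j ∧ N ≤ i ∧ K * b j ≤ b i := by
  -- The reflection k ↦ -k turns falls on the right into rises on the left.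
  obtain ⟨i, j, hij, hj, hr⟩ := exists_rise_left (b := fun k => b (-k)) (fun k => hb _)
    (fun K hK => by
      obtain ⟨i, j, hij, hi, hf⟩ := h K hK
      exact ⟨-j, -i, by omega, by omega, by simpa using hf⟩) (-N) hK
  exact ⟨-j, -i, by omega, by omega, hr⟩

/-! ### Dyadic blocks in a rearrangement invariant space -/

lemma dilateTwo_charInterval (a b : ℝ) :
    dilateTwo (charInterval a b) = charInterval (2 * a) (2 * b) := by
  ext
  filter_upwards [coeFn_charInterval (2 * a) (2 * b), coeFn_dilateTwo (charInterval a b),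
    quasiMeasurePreserving_half.ae (coeFn_charInterval a b)] with s h1 h2 h3
  rw [h1, h2, h3]
  have : s ∈ Ioo (2 * a) (2 * b) ↔ s / 2 ∈ Ioo a b := by
    constructor <;> rintro ⟨a, b⟩ <;> constructor <;> linarith
  simp only [indicator, this]

lemma distribution_charInterval_dyadic (k : ℤ) (τ : ℝ≥0∞) :
    distribution (charInterval (2 ^ k) (2 ^ (k + 1))) τ =
      distribution (charInterval 0 (2 ^ k)) τ := by
  rw [distribution_charInterval (zpow_pos two_pos k).le, distribution_charInterval le_rfl,
    zpow_add_one₀ two_ne_zero]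
  congr 2
  ring

lemma RISpace.charInterval_dyadic_mem (X : RISpace) [Nontrivial X.carrier] (k : ℤ) :
    charInterval (2 ^ k) (2 ^ (k + 1)) ∈ X.carrier :=
  (X.of_distribution_le _ ⟨charInterval 0 (2 ^ k), X.charInterval_mem _⟩
    fun τ => (distribution_charInterval_dyadic k τ).le).1

/-- The characteristic function of `(2 ^ k, 2 ^ (k + 1))` as an element of `X`. -/
noncomputable def RISpace.dyadicBlock (X : RISpace) [Nontrivial X.carrier] (k : ℤ) : X.carrier :=
  ⟨charInterval (2 ^ k) (2 ^ (k + 1)), X.charInterval_dyadic_mem k⟩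

lemma RISpace.norm_dyadicBlock (X : RISpace) [Nontrivial X.carrier] (k : ℤ) :
    ‖X.dyadicBlock k‖ = X.fundamental (2 ^ k) :=
  le_antisymm
    (X.of_distribution_le _ ⟨charInterval 0 (2 ^ k), X.charInterval_mem _⟩
      fun τ => (distribution_charInterval_dyadic k τ).le).2
    (X.of_distribution_le _ (X.dyadicBlock k)
      fun τ => (distribution_charInterval_dyadic k τ).ge).2

lemma RISpace.doubling_dyadicBlock (X : RISpace) [Nontrivial X.carrier] (k : ℤ) :
    X.doubling (X.dyadicBlock k) = X.dyadicBlock (k + 1) := by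
  refine Subtype.ext ?_
  change dilateTwo (charInterval _ _) = charInterval _ _
  rw [dilateTwo_charInterval, zpow_add_one₀ two_ne_zero (k + 1), zpow_add_one₀ two_ne_zero k]
  congr 1 <;> ring

lemma RISpace.coeFn_sum_dyadicBlock (X : RISpace) [Nontrivial X.carrier] (S : Finset ℤ)
    (c : ℤ → ℝ) : (∑ k ∈ S, c k • X.dyadicBlock k : X.carrier).1 =ᵐ[halfLine]
      fun s => ∑ k ∈ S, c k * (Ioo ((2 : ℝ) ^ k) (2 ^ (k + 1))).indicator (fun _ => (1 : ℝ)) s := by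
  induction S using Finset.induction_on with
  | empty =>
    simp only [Finset.sum_empty]
    exact AEEqFun.coeFn_zero
  | insert k S hk ih =>
    rw [Finset.sum_insert hk, Submodule.coe_add, Submodule.coe_smul]
    filter_upwards [ih, AEEqFun.coeFn_add (c k • (X.dyadicBlock k).1)
      (∑ k ∈ S, c k • X.dyadicBlock k : X.carrier).1,
      AEEqFun.coeFn_smul (c k) (X.dyadicBlock k).1,
      coeFn_charInterval (2 ^ k) (2 ^ (k + 1))] with s h1 h2 h3 h4
    rw [h2, Pi.add_apply, h1, h3, Pi.smul_apply, Finset.sum_insert hk, smul_eq_mul]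
    congr 2

/-- The indicators are nonnegative, so the bound on coefficients passes to a pointwise bound, and
the ideal property applies. -/
lemma RISpace.norm_sum_dyadicBlock_le (X : RISpace) [Nontrivial X.carrier] (S : Finset ℤ)
    (c d : ℤ → ℝ) (h : ∀ k ∈ S, |c k| ≤ d k) :
    ‖∑ k ∈ S, c k • X.dyadicBlock k‖ ≤ ‖∑ k ∈ S, d k • X.dyadicBlock k‖ := by
  refine (X.isRearrangementInvariant.ideal (∑ k ∈ S, c k • X.dyadicBlock k : X.carrier).1
    (∑ k ∈ S, d k • X.dyadicBlock k) ?_).2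
  filter_upwards [X.coeFn_sum_dyadicBlock S c, X.coeFn_sum_dyadicBlock S d] with s h1 h2
  rw [h1, h2]
  refine ((Finset.abs_sum_le_sum_abs _ _).trans (Finset.sum_le_sum fun k hk => ?_)).trans
    (le_abs_self _)
  have h0 : 0 ≤ (Ioo ((2 : ℝ) ^ k) (2 ^ (k + 1))).indicator (fun _ => (1 : ℝ)) s :=
    indicator_nonneg (fun _ _ => zero_le_one) s
  rw [abs_mul, abs_of_nonneg h0]
  exact mul_le_mul_of_nonneg_right (h k hk) h0

/-! ### Growth of the fundamental function along dyadic scales -/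

/-- Since log₂ r < l, the n-th supremum eventually exceeds r^n, and then so does one of the
quotients. -/
lemma RISpace.eventually_exists_lt_dilation (X : RISpace) [Nontrivial X.carrier] {D : ℕ → Set ℝ}
    (hD : ∀ n, D n ⊆ Ioi 0) (hne : ∀ n, (D n).Nonempty) {t : ℕ → ℝ} (ht : ∀ n, 0 < t n) {l r : ℝ}
    (hl : Tendsto (fun n : ℕ => 1 / (n : ℝ) * Real.logb 2
      (sSup ((fun s => X.fundamental (t n * s) / X.fundamental s) '' D n))) atTop (𝓝 l))
    (hr0 : 0 < r) (hr : r < 2 ^ l) :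
    ∀ᶠ n : ℕ in atTop, ∃ s ∈ D n, r ^ n * X.fundamental s < X.fundamental (t n * s) := by
  have hlog : Real.logb 2 r < l := (Real.logb_lt_iff_lt_rpow one_lt_two hr0).2 hr
  filter_upwards [hl.eventually (lt_mem_nhds hlog), eventually_gt_atTop 0] with n hn hn0
  have hn0' : (0 : ℝ) < n := by exact_mod_cast hn0
  have hM : 0 < sSup ((fun s => X.fundamental (t n * s) / X.fundamental s) '' D n) := by
    obtain ⟨s, hs⟩ := hne n
    refine lt_of_lt_of_le ?_ (le_csSup (X.bddAbove_dilation (hD n) _) ⟨s, hs, rfl⟩)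
    exact div_pos (X.fundamental_pos (mul_pos (ht n) (hD n hs))) (X.fundamental_pos (hD n hs))
  rw [one_div, lt_inv_mul_iff₀ hn0', ← Real.logb_pow,
    Real.logb_lt_logb_iff one_lt_two (pow_pos hr0 n) hM] at hn
  obtain ⟨_, ⟨s, hs, rfl⟩, h⟩ := exists_lt_of_lt_csSup ((hne n).image _) hn
  exact ⟨s, hs, (lt_div_iff₀ (X.fundamental_pos (hD n hs))).1 h⟩

lemma eventually_mul_pow_le {r q : ℝ} (hr : 0 < r) (hrq : r < q) (K : ℝ) :
    ∀ᶠ n : ℕ in atTop, K * r ^ n ≤ q ^ n := by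
  have := tendsto_pow_atTop_atTop_of_one_lt ((one_lt_div hr).2 hrq)
  filter_upwards [this.eventually_ge_atTop K] with n hn
  rwa [div_pow, le_div_iff₀ (pow_pos hr n)] at hn

/-- Rises of `φ (2 ^ k) / r ^ k` from rises of `φ` between arbitrary points. -/
lemma RISpace.exists_rise (X : RISpace) [Nontrivial X.carrier] {D : ℕ → Set ℝ}
    (hD : ∀ n, D n ⊆ Ioi 0) (hne : ∀ n, (D n).Nonempty) {l r : ℝ}
    (hl : Tendsto (fun n : ℕ => 1 / (n : ℝ) * Real.logb 2
      (sSup ((fun s => X.fundamental (2 ^ n * s) / X.fundamental s) '' D n))) atTop (𝓝 l))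
    (hr0 : 0 < r) (hr : r < 2 ^ l) (K : ℝ) :
    ∃ (n : ℕ) (i : ℤ) (s : ℝ), s ∈ D n ∧ (2 : ℝ) ^ i ≤ s ∧
      K * (X.fundamental (2 ^ i) / r ^ i) ≤ X.fundamental (2 ^ (i + n)) / r ^ (i + n) := by
  -- The gap between r and q lets q^n absorb both K and the factor 2 lost when s is rounded down to
  -- a power of 2.
  obtain ⟨q, hrq, hq⟩ := exists_between hr
  obtain ⟨n, ⟨s, hs, h⟩, hn⟩ := ((X.eventually_exists_lt_dilation hD hne
    (fun n => pow_pos two_pos n) hl (hr0.trans hrq) hq).and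
    (eventually_mul_pow_le hr0 hrq (2 * K))).exists
  obtain ⟨i, hi1, hi2⟩ := exists_mem_Ico_zpow (mem_Ioi.1 (hD n hs)) one_lt_two
  refine ⟨n, i, s, hs, hi1, ?_⟩
  have h1 : X.fundamental (2 ^ n * s) ≤ 2 * X.fundamental (2 ^ (i + n)) := by
    refine (X.fundamental_mono ?_).trans (X.fundamental_two_mul_le _)
    rw [zpow_add₀ two_ne_zero, zpow_natCast]
    rw [zpow_add_one₀ two_ne_zero] at hi2
    nlinarith [pow_pos (two_pos : (0 : ℝ) < 2) n]
  have h2 := X.fundamental_mono hi1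
  have h3 : 0 < X.fundamental (2 ^ i) := X.fundamental_pos (zpow_pos two_pos i)
  have h4 : q ^ n * X.fundamental (2 ^ i) ≤ 2 * X.fundamental (2 ^ (i + n)) :=
    (mul_le_mul_of_nonneg_left h2 (pow_pos (hr0.trans hrq) n).le).trans (h.le.trans h1)
  have h5 := mul_le_mul_of_nonneg_right hn h3.le
  have hri := zpow_pos hr0 i
  rw [zpow_add₀ hr0.ne', zpow_natCast, ← mul_div_assoc, div_le_div_iff₀ hri
    (mul_pos hri (pow_pos hr0 n))]
  have h6 : K * X.fundamental (2 ^ i) * r ^ n ≤ X.fundamental (2 ^ (i + n)) := by linarith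
  nlinarith

/-- Falls of `φ (2 ^ k) / r ^ k` from slow growth of `φ` between arbitrary points. -/
lemma RISpace.exists_fall (X : RISpace) [Nontrivial X.carrier] {D : ℕ → Set ℝ}
    (hD : ∀ n, D n ⊆ Ioi 0) (hne : ∀ n, (D n).Nonempty) {l r : ℝ}
    (hl : Tendsto (fun n : ℕ => 1 / (n : ℝ) * Real.logb 2
      (sSup ((fun s => X.fundamental (2 ^ (-(n : ℤ)) * s) / X.fundamental s) '' D n)))
      atTop (𝓝 (-l)))
    (hr : 2 ^ l < r) (K : ℝ) :
    ∃ (n : ℕ) (i : ℤ) (s : ℝ), s ∈ D n ∧ s < (2 : ℝ) ^ (i + n + 1) ∧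
      K * (X.fundamental (2 ^ (i + n)) / r ^ (i + n)) ≤ X.fundamental (2 ^ i) / r ^ i := by
  obtain ⟨q, hq, hqr⟩ := exists_between hr
  have hq0 : 0 < q := lt_trans (Real.rpow_pos_of_pos two_pos l) hq
  have hr0 : 0 < r := hq0.trans hqr
  -- Under dilation by 2^(-n) the growth rate is 2^(-l), so q⁻¹ is the rate to beat; the resulting
  -- point s satisfies φ(s) < q^n φ(2^(-n) s).
  have hq' : q⁻¹ < 2 ^ (-l) := by
    rw [Real.rpow_neg two_pos.le]
    exact inv_strictAnti₀ (Real.rpow_pos_of_pos two_pos l) hq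
  obtain ⟨n, ⟨s, hs, h⟩, hn⟩ := ((X.eventually_exists_lt_dilation hD hne
    (fun n => zpow_pos two_pos _) hl (inv_pos.2 hq0) hq').and
    (eventually_mul_pow_le hq0 hqr (2 * K))).exists
  obtain ⟨j, hj1, hj2⟩ := exists_mem_Ico_zpow (mem_Ioi.1 (hD n hs)) one_lt_two
  obtain ⟨i, rfl⟩ : ∃ i : ℤ, j = i + n := ⟨j - n, by ring⟩
  refine ⟨n, i, s, hs, hj2, ?_⟩
  have h1 : X.fundamental (2 ^ (-(n : ℤ)) * s) ≤ 2 * X.fundamental (2 ^ i) := by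
    refine (X.fundamental_mono ?_).trans (X.fundamental_two_mul_le _)
    have : (2 : ℝ) * 2 ^ i = 2 ^ (-(n : ℤ)) * 2 ^ (i + n + 1) := by
      rw [← zpow_add₀ two_ne_zero, ← zpow_one_add₀ two_ne_zero]
      congr 1; ring
    rw [this]
    exact mul_le_mul_of_nonneg_left hj2.le (zpow_pos two_pos _).le
  have h2 := X.fundamental_mono hj1
  have h3 : 0 < X.fundamental (2 ^ (i + n : ℤ)) := X.fundamental_pos (zpow_pos two_pos _)
  have h4 : X.fundamental (2 ^ (i + n : ℤ)) ≤ q ^ n * (2 * X.fundamental (2 ^ i)) := by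
    rw [← inv_mul_le_iff₀ (pow_pos hq0 n), ← inv_pow]
    exact (mul_le_mul_of_nonneg_left h2 (pow_pos (inv_pos.2 hq0) n).le).trans (h.le.trans h1)
  have hri := zpow_pos hr0 i
  rw [zpow_add₀ hr0.ne', zpow_natCast, ← mul_div_assoc, div_le_div_iff₀
    (mul_pos hri (pow_pos hr0 n)) hri]
  have h5 : 0 < X.fundamental (2 ^ i) := X.fundamental_pos (zpow_pos two_pos i)
  rcases le_or_gt K 0 with hK | hK
  · refine le_trans (mul_nonpos_of_nonpos_of_nonneg (mul_nonpos_of_nonpos_of_nonneg hK h3.le)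
      hri.le) ?_
    positivity
  have h6 : K * X.fundamental (2 ^ (i + n : ℤ)) ≤ X.fundamental (2 ^ i) * r ^ n := by
    have h7 := mul_le_mul_of_nonneg_left h4 hK.le
    have h8 := mul_le_mul_of_nonneg_right hn h5.le
    linarith
  nlinarith

lemma RISpace.exists_rise_of_lt_upperIndex (X : RISpace) [Nontrivial X.carrier] {r : ℝ}
    (hr0 : 0 < r) (hr : r < 2 ^ upperIndex (dilationFn X.fundamental)) (K : ℝ) :
    ∃ i j : ℤ, i ≤ j ∧
      K * (X.fundamental (2 ^ i) / r ^ i) ≤ X.fundamental (2 ^ j) / r ^ j := by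
  obtain ⟨n, i, s, -, -, h⟩ := X.exists_rise (D := fun _ => Ioi 0) (fun _ => subset_rfl)
    (fun _ => nonempty_Ioi) X.tendsto_upperIndex hr0 hr K
  exact ⟨i, i + n, by omega, h⟩

lemma RISpace.exists_rise_of_lt_upperIndex_zero (X : RISpace) [Nontrivial X.carrier] {r : ℝ}
    (hr0 : 0 < r) (hr : r < 2 ^ upperIndex (dilationFnZero X.fundamental)) (K : ℝ) :
    ∃ i j : ℤ, i ≤ j ∧ j ≤ 0 ∧
      K * (X.fundamental (2 ^ i) / r ^ i) ≤ X.fundamental (2 ^ j) / r ^ j := by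
  obtain ⟨n, i, s, hs, his, h⟩ := X.exists_rise
    (D := fun n => Ioc 0 (min 1 (1 / 2 ^ n))) (fun _ _ hs => hs.1)
    (fun _ => nonempty_Ioc.2 (by positivity)) X.tendsto_upperIndex_zero hr0 hr K
  refine ⟨i, i + n, by omega, ?_, h⟩
  -- Rounding s down keeps 2^i ≤ s ≤ 2^(-n), so the rise ends at i + n ≤ 0.
  have h1 : (2 : ℝ) ^ i ≤ 2 ^ (-(n : ℤ)) := by
    rw [zpow_neg, zpow_natCast, ← one_div]
    exact his.trans (hs.2.trans (min_le_right _ _))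
  have := (zpow_le_zpow_iff_right₀ one_lt_two).1 h1
  omega

lemma RISpace.exists_fall_of_lowerIndex_lt (X : RISpace) [Nontrivial X.carrier] {r : ℝ}
    (hr : 2 ^ lowerIndex (dilationFn X.fundamental) < r) (K : ℝ) :
    ∃ i j : ℤ, i ≤ j ∧
      K * (X.fundamental (2 ^ j) / r ^ j) ≤ X.fundamental (2 ^ i) / r ^ i := by
  obtain ⟨n, i, s, -, -, h⟩ := X.exists_fall (D := fun _ => Ioi 0) (fun _ => subset_rfl)
    (fun _ => nonempty_Ioi) X.tendsto_lowerIndex hr K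
  exact ⟨i, i + n, by omega, h⟩

lemma RISpace.exists_fall_of_lowerIndex_infty_lt (X : RISpace) [Nontrivial X.carrier] {r : ℝ}
    (hr : 2 ^ lowerIndex (dilationFnInfty X.fundamental) < r) (K : ℝ) :
    ∃ i j : ℤ, i ≤ j ∧ 0 ≤ i ∧
      K * (X.fundamental (2 ^ j) / r ^ j) ≤ X.fundamental (2 ^ i) / r ^ i := by
  obtain ⟨n, i, s, hs, his, h⟩ := X.exists_fall
    (D := fun n => Ici (max 1 (1 / 2 ^ (-(n : ℤ)))))
    (fun _ _ hs => mem_Ioi.2 (lt_of_lt_of_le one_pos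
      ((le_max_left _ _).trans (mem_Ici.1 hs))))
    (fun _ => nonempty_Ici) X.tendsto_lowerIndex_infty hr K
  refine ⟨i, i + n, by omega, ?_, h⟩
  -- Rounding down may put 2^(i + n) below s, but the strict inequality between integer powers still
  -- gives n < i + n + 1, hence 0 ≤ i.
  have h1 : (2 : ℝ) ^ (n : ℤ) < 2 ^ (i + n + 1) := by
    have h2 : 1 / (2 : ℝ) ^ (-(n : ℤ)) ≤ s := (le_max_right _ _).trans hs
    rw [zpow_neg, one_div, inv_inv] at h2
    exact h2.trans_lt his
  have := (zpow_lt_zpow_iff_right₀ one_lt_two).1 h1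
  omega

/-! ### Approximate eigenvalues of the doubling operator -/

lemma RISpace.isApproximateEigenvalue_doubling (X : RISpace) [Nontrivial X.carrier] {ev : ℝ}
    (hev : 0 < ev)
    (hpeak : ∀ ρ : ℝ, 1 < ρ → ∀ K : ℝ, 0 < K → ∃ i₁ j₁ i₂ j₂ : ℤ, i₁ ≤ j₁ ∧ j₁ ≤ i₂ ∧ i₂ ≤ j₂ ∧
      K * (X.fundamental (2 ^ i₁) / (ev / ρ) ^ i₁) ≤ X.fundamental (2 ^ j₁) / (ev / ρ) ^ j₁ ∧
      K * (X.fundamental (2 ^ j₂) / (ev * ρ) ^ j₂) ≤ X.fundamental (2 ^ i₂) / (ev * ρ) ^ i₂) :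
    IsApproximateEigenvalue X.doubling ev := by
  refine isApproximateEigenvalue_of_shift X.doubling_dyadicBlock (fun k => ?_) (fun k => ?_)
    X.norm_sum_dyadicBlock_le hev ?_
  · rw [X.norm_dyadicBlock]
    exact X.fundamental_pos (zpow_pos two_pos k)
  · rw [X.norm_dyadicBlock, X.norm_dyadicBlock, zpow_add_one₀ two_ne_zero, mul_comm]
    exact X.fundamental_two_mul_le _
  · simpa only [X.norm_dyadicBlock] using hpeak

/-- The fall may occur anywhere, so it is fixed first; the rise, available on the negative
half-axis, is then placed to its left. -/
lemma RISpace.isApproximateEigenvalue_of_le_upperIndex_zero (X : RISpace) [Nontrivial X.carrier]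
    {ev : ℝ} (h₁ : 2 ^ lowerIndex (dilationFn X.fundamental) ≤ ev)
    (h₂ : ev ≤ 2 ^ upperIndex (dilationFnZero X.fundamental)) :
    IsApproximateEigenvalue X.doubling ev := by
  have hev : 0 < ev := lt_of_lt_of_le (Real.rpow_pos_of_pos two_pos _) h₁
  refine X.isApproximateEigenvalue_doubling hev fun ρ hρ K hK => ?_
  have hρ0 : 0 < ρ := one_pos.trans hρ
  obtain ⟨i₂, j₂, h, hf⟩ := X.exists_fall_of_lowerIndex_lt
    (h₁.trans_lt (lt_mul_of_one_lt_right hev hρ)) K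
  obtain ⟨i₁, j₁, h', hN, hr⟩ := exists_rise_left
    (b := fun k : ℤ => X.fundamental (2 ^ k) / (ev / ρ) ^ k)
    (fun k => div_pos (X.fundamental_pos (zpow_pos two_pos k)) (zpow_pos (div_pos hev hρ0) k))
    (fun K _ => X.exists_rise_of_lt_upperIndex_zero (div_pos hev hρ0)
      ((div_lt_self hev hρ).trans_le h₂) K) i₂ hK
  exact ⟨i₁, j₁, i₂, j₂, h', hN, h, hr, hf⟩

/-- Here it is the rise that may occur anywhere, and the fall is placed to its right. -/
lemma RISpace.isApproximateEigenvalue_of_lowerIndex_infty_le (X : RISpace) [Nontrivial X.carrier]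
    {ev : ℝ} (h₁ : 2 ^ lowerIndex (dilationFnInfty X.fundamental) ≤ ev)
    (h₂ : ev ≤ 2 ^ upperIndex (dilationFn X.fundamental)) :
    IsApproximateEigenvalue X.doubling ev := by
  have hev : 0 < ev := lt_of_lt_of_le (Real.rpow_pos_of_pos two_pos _) h₁
  refine X.isApproximateEigenvalue_doubling hev fun ρ hρ K hK => ?_
  have hρ0 : 0 < ρ := one_pos.trans hρ
  obtain ⟨i₁, j₁, h, hr⟩ := X.exists_rise_of_lt_upperIndex (div_pos hev hρ0)
    ((div_lt_self hev hρ).trans_le h₂) K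
  obtain ⟨i₂, j₂, h', hN, hf⟩ := exists_fall_right
    (b := fun k : ℤ => X.fundamental (2 ^ k) / (ev * ρ) ^ k)
    (fun k => div_pos (X.fundamental_pos (zpow_pos two_pos k)) (zpow_pos (mul_pos hev hρ0) k))
    (fun K _ => X.exists_fall_of_lowerIndex_infty_lt
      (h₁.trans_lt (lt_mul_of_one_lt_right hev hρ)) K) j₁ hK
  exact ⟨i₁, j₁, i₂, j₂, h, hN, h', hr, hf⟩

theorem mainTheorem8 (X : RISpace) [Nontrivial X.carrier]
    [TopologicalSpace.SeparableSpace X.carrier] :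
    (lowerIndex (dilationFnInfty X.fundamental) ≤ upperIndex (dilationFnZero X.fundamental) →
      ∀ ev ∈ Icc ((2 : ℝ) ^ lowerIndex (dilationFn X.fundamental))
          ((2 : ℝ) ^ upperIndex (dilationFn X.fundamental)),
        IsApproximateEigenvalue X.doubling ev) ∧
    (lowerIndex (dilationFnInfty X.fundamental) > upperIndex (dilationFnZero X.fundamental) →
      ∀ ev ∈ Icc ((2 : ℝ) ^ lowerIndex (dilationFn X.fundamental))
            ((2 : ℝ) ^ upperIndex (dilationFnZero X.fundamental)) ∪
          Icc ((2 : ℝ) ^ lowerIndex (dilationFnInfty X.fundamental))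
            ((2 : ℝ) ^ upperIndex (dilationFn X.fundamental)),
        IsApproximateEigenvalue X.doubling ev) := by
  refine ⟨fun hle ev hev => ?_, fun _ ev hev => ?_⟩
  -- Above 2^(ν⁰) the point is also above 2^(μ^∞), so the two intervals leave no gap.
  · rcases le_total ev (2 ^ upperIndex (dilationFnZero X.fundamental)) with h | h
    · exact X.isApproximateEigenvalue_of_le_upperIndex_zero hev.1 h
    · exact X.isApproximateEigenvalue_of_lowerIndex_infty_le
        ((Real.rpow_le_rpow_of_exponent_le one_le_two hle).trans h) hev.2
  · rcases hev with hev | hev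
    · exact X.isApproximateEigenvalue_of_le_upperIndex_zero hev.1 hev.2
    · exact X.isApproximateEigenvalue_of_lowerIndex_infty_le hev.1 hev.2
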